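/- Let $d_1,\dots,d_r$ be natural numbers with greatest common divisor $1$, let $R=\mathbb R[t^{d_1},\dots,t^{d_r}]\subseteq\mathbb R[t]$, and for $n\ge 0$ let $R_{\le n}$ be the real vector space of all polynomials in $R$ of degree at most $n$. Let $\mathfrak c$ be the conductor of $R$, i.e. the least integer $c\ge 0$ such that $t^n\in R$ for all $n\ge c$, and let $D_{\mathfrak c}$ be the Descartes number, i.e. the maximal number of different real zeros of a nonzero polynomial in $R_{\le\mathfrak c}$. A linear functional $L:R_{\le 2k}\to\mathbb R$ is called a moment functional if there is a (positive) Borel measure $\mu$ on $\mathbb R$ such that every $f\in R_{\le 2k}$ is $\mu$-integrable and $L(f)=\int f\,d\mu$ for all $f\in R_{\le 2k}$; the point evaluation at $x\in\mathbb R$ is the functional $l_x(f)=f(x)$. Let $k\ge\mathfrak c$. Then every moment functional $L:R_{\le 2k}\to\mathbb R$ is a conic combination (a linear combination with nonnegative coefficients) of at most $$k+1-\left\lceil\frac{\mathfrak c-D_{\mathfrak c}-1}{2}\right\rceil$$ point evaluations. Moreover, there is a moment functional $L:R_{\le 2k}\to\mathbb R$ that is not a conic combination of fewer than $k-(\mathfrak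 c-D_{\mathfrak c})$ point evaluations. -/

import Mathlib

noncomputable section

open Polynomial MeasureTheory

namespace SparseMoment

/-- The ring `R = ℝ[t^{d₁}, …, t^{d_r}]` as a subalgebra of `ℝ[t]`. -/
def gapRing {r : ℕ} (d : Fin r → ℕ) : Subalgebra ℝ ℝ[X] :=
  Algebra.adjoin ℝ (Set.range fun i => (X : ℝ[X]) ^ d i)

/-- The vector space `R_{≤ n}` of the polynomials in `R` of degree at most `n`. -/
def gapRingLE {r : ℕ} (d : Fin r → ℕ) (n : ℕ) : Submodule ℝ ℝ[X] :=
  Subalgebra.toSubmodule (gapRing d) ⊓ degreeLE ℝ (n : WithBot ℕ)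

/-- The conductor of `R`: the least `c` such that `t ^ n ∈ R` for all `n ≥ c`. -/
def conductor {r : ℕ} (d : Fin r → ℕ) : ℕ :=
  sInf {c : ℕ | ∀ n : ℕ, c ≤ n → (X : ℝ[X]) ^ n ∈ gapRing d}

/-- The `k`-th Descartes number of `R`: the maximal number of different real zeros of a
nonzero polynomial in `R_{≤ k}`. -/
def descartesNumber {r : ℕ} (d : Fin r → ℕ) (k : ℕ) : ℕ :=
  sSup {N : ℕ | ∃ f ∈ gapRingLE d k, f ≠ 0 ∧ {x : ℝ | f.eval x = 0}.ncard = N}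

/-- The point evaluation `l_x : V → ℝ`, `f ↦ f(x)`, on a space `V` of polynomials. -/
def pointEval (V : Submodule ℝ ℝ[X]) (x : ℝ) : V →ₗ[ℝ] ℝ :=
  (Polynomial.leval x).comp V.subtype

/-- `L` is a moment functional: it is integration against some positive Borel measure on `ℝ`
for which all elements of `V` are integrable. -/
def IsMomentFunctional {V : Submodule ℝ ℝ[X]} (L : V →ₗ[ℝ] ℝ) : Prop :=
  ∃ μ : Measure ℝ, ∀ f : V, Integrable (fun x : ℝ => (f : ℝ[X]).eval x) μ ∧
    L f = ∫ x, (f : ℝ[X]).eval x ∂μ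

/-- `L` is a conic combination of `n` point evaluations. Coefficients may vanish and points may
repeat, so this is the same as being a conic combination of at most `n` point evaluations. -/
def IsConicCombination {V : Submodule ℝ ℝ[X]} (L : V →ₗ[ℝ] ℝ) (n : ℕ) : Prop :=
  ∃ (x : Fin n → ℝ) (a : Fin n → ℝ), (∀ i, 0 ≤ a i) ∧ L = ∑ i, a i • pointEval V (x i)

/-- For coprime exponents the minimum defining the conductor is attained. -/
theorem conductor_isLeast {r : ℕ} (d : Fin r → ℕ) (hd : Finset.univ.gcd d = 1) :
    IsLeast {c : ℕ | ∀ n : ℕ, c ≤ n → (X : ℝ[X]) ^ n ∈ gapRing d} (conductor d) := by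
  have hne : {c : ℕ | ∀ n : ℕ, c ≤ n → (X : ℝ[X]) ^ n ∈ gapRing d}.Nonempty := by
    obtain ⟨c, hc⟩ := Nat.exists_mem_closure_of_ge (Set.range d)
    refine ⟨c, fun n hn => ?_⟩
    have h1 : Nat.setGcd (Set.range d) = 1 := by
      apply Nat.dvd_one.mp
      rw [← hd]
      exact Finset.dvd_gcd fun i _ => Nat.setGcd_dvd_of_mem ⟨i, rfl⟩
    have h2 := hc n hn (by rw [h1]; exact one_dvd n)
    clear hn
    induction h2 using AddSubmonoid.closure_induction with
    | mem x hx =>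
      obtain ⟨i, rfl⟩ := hx
      exact Algebra.subset_adjoin ⟨i, rfl⟩
    | zero => simp
    | add x y _ _ hx hy => rw [pow_add]; exact (gapRing d).mul_mem hx hy
  exact ⟨Nat.sInf_mem hne, fun c hc => Nat.sInf_le hc⟩

/-- The maximum defining the Descartes number is attained. -/
theorem descartesNumber_isGreatest {r : ℕ} (d : Fin r → ℕ) (k : ℕ) :
    IsGreatest {N : ℕ | ∃ f ∈ gapRingLE d k, f ≠ 0 ∧ {x : ℝ | f.eval x = 0}.ncard = N}
      (descartesNumber d k) := by
  have hb : BddAbove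
      {N : ℕ | ∃ f ∈ gapRingLE d k, f ≠ 0 ∧ {x : ℝ | f.eval x = 0}.ncard = N} := by
    refine ⟨k, ?_⟩
    rintro N ⟨f, hf, hf0, rfl⟩
    have h1 : {x : ℝ | f.eval x = 0} = (f.roots.toFinset : Set ℝ) := by
      ext x; simp [hf0]
    rw [h1, Set.ncard_coe_finset]
    exact (Multiset.toFinset_card_le _).trans ((card_roots' f).trans
      (natDegree_le_of_degree_le (mem_degreeLE.mp hf.2)))
  refine ⟨Nat.sSup_mem ⟨_, 1, ⟨(gapRing d).one_mem, ?_⟩, one_ne_zero, rfl⟩ hb,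
    fun N hN => le_csSup hb hN⟩
  exact mem_degreeLE.mpr (degree_one_le.trans (by exact_mod_cast Nat.zero_le k))

end SparseMoment

end

/-!
Let `D n` be the Descartes number of `R_{≤ n}`, and let `n ≥ c`. If `f ∈ R_{≤ n}` is nonzero, then
for small `ε` the polynomials `f + ε X ^ (n + 1)` and `f - ε X ^ (n + 1)` together have two zeros
near each zero of `f` and one more beyond either end, so one of them has more zeros than `f`; hence
`D (n + 1) ≥ D n + 1`. In the same way, replacing the monomial by the constant `1`, a nonnegative
`f ∈ R_{≤ 2k}` is seen to have at most `D (2k) / 2` zeros. By Rolle's theorem, applied to reciprocal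
polynomials so that the small exponents survive, `D (c + j) ≤ D c + j + 1`.

If a moment functional vanishes on a nonzero nonnegative polynomial, its measure is supported on the
zeros, of which there are at most `D (2k) / 2`. Otherwise one subtracts the largest multiple of the
evaluation at a point `x` that leaves the functional nonnegative on nonnegative polynomials. It then
vanishes on such a polynomial, which has full degree `2k` if `x` is large. Full degree makes up for
the missing measure: a polynomial that is nonnegative on the zeros becomes nonnegative on the whole
line after adding an arbitrarily small constant and a multiple of the extremal polynomial.

For the lower bound, sum the evaluations at the zeros of some `p ∈ R_{≤ k}` with `D k` zeros; the
value at `p ^ 2` confines every representation to these zeros, where evaluations are independent.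
-/

noncomputable section

open Polynomial MeasureTheory Filter Set Topology
open scoped Finset

namespace SparseMoment

section RealZeros

open Classical in
/-- The finite set of real zeros of `p` in `s`. It is empty for `p = 0`, whose `roots` are empty
by convention. -/
def zerosIn (p : ℝ[X]) (s : Set ℝ) : Finset ℝ :=
  p.roots.toFinset.filter (· ∈ s)

variable {f p q : ℝ[X]} {s t : Set ℝ} {a b x z : ℝ}

theorem mem_roots_toFinset (hp : p ≠ 0) : x ∈ p.roots.toFinset ↔ p.eval x = 0 := by
  rw [Multiset.mem_toFinset, mem_roots hp, IsRoot.def]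

theorem mem_zerosIn : x ∈ zerosIn p s ↔ x ∈ p.roots.toFinset ∧ x ∈ s := by
  simp only [zerosIn, Finset.mem_filter]

theorem card_zerosIn_le_card_roots (p : ℝ[X]) (s : Set ℝ) :
    #(zerosIn p s) ≤ #p.roots.toFinset :=
  Finset.card_le_card fun _ hx => (mem_zerosIn.mp hx).1

theorem zerosIn_mono (p : ℝ[X]) (h : s ⊆ t) : zerosIn p s ⊆ zerosIn p t :=
  fun _ hx => mem_zerosIn.mpr ((mem_zerosIn.mp hx).imp_right (@h _))

theorem disjoint_zerosIn (p : ℝ[X]) (h : Disjoint s t) : Disjoint (zerosIn p s) (zerosIn p t) :=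
  Finset.disjoint_left.mpr fun _ hs ht =>
    disjoint_left.mp h (mem_zerosIn.mp hs).2 (mem_zerosIn.mp ht).2

theorem card_zerosIn_add_le (p : ℝ[X]) (h : Disjoint s t) :
    #(zerosIn p s) + #(zerosIn p t) ≤ #(zerosIn p (s ∪ t)) := by
  rw [← Finset.card_union_of_disjoint (disjoint_zerosIn p h)]
  exact Finset.card_le_card (Finset.union_subset (zerosIn_mono p subset_union_left)
    (zerosIn_mono p subset_union_right))

theorem sum_card_zerosIn_le {ι : Type*} (p : ℝ[X]) {I : Finset ι} {t : ι → Set ℝ}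
    (hdisj : (I : Set ι).PairwiseDisjoint t) (hsub : ∀ i ∈ I, t i ⊆ s) :
    ∑ i ∈ I, #(zerosIn p (t i)) ≤ #(zerosIn p s) := by
  rw [← Finset.card_biUnion fun i hi j hj hij => disjoint_zerosIn p (hdisj hi hj hij)]
  exact Finset.card_le_card <| Finset.biUnion_subset.mpr fun i hi => zerosIn_mono p (hsub i hi)

theorem exists_eval_eq_zero_of_mul_neg (hab : a < b) (h : p.eval a * p.eval b < 0) :
    ∃ x ∈ Ioo a b, p.eval x = 0 := by
  rcases mul_neg_iff.mp h with ⟨ha, hb⟩ | ⟨ha, hb⟩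
  · exact intermediate_value_Ioo' hab.le p.continuousOn ⟨hb, ha⟩
  · exact intermediate_value_Ioo hab.le p.continuousOn ⟨ha, hb⟩

theorem ne_zero_of_eval_ne_zero (h : p.eval x ≠ 0) : p ≠ 0 := by
  rintro rfl
  exact h eval_zero

theorem one_le_card_zerosIn (hp : p ≠ 0) (hz : p.eval z = 0) (hs : z ∈ s) :
    1 ≤ #(zerosIn p s) :=
  Finset.card_pos.mpr ⟨z, mem_zerosIn.mpr ⟨(mem_roots_toFinset hp).mpr hz, hs⟩⟩

theorem one_le_card_zerosIn_Ioo (hab : a < b) (h : p.eval a * p.eval b < 0) :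
    1 ≤ #(zerosIn p (Ioo a b)) := by
  obtain ⟨x, hx, hx0⟩ := exists_eval_eq_zero_of_mul_neg hab h
  exact one_le_card_zerosIn (ne_zero_of_eval_ne_zero (left_ne_zero_of_mul h.ne)) hx0 hx

theorem two_le_card_zerosIn_Ioo (haz : a < z) (hzb : z < b) (ha : p.eval a * p.eval z < 0)
    (hb : p.eval z * p.eval b < 0) : 2 ≤ #(zerosIn p (Ioo a b)) := by
  obtain ⟨x, hx, hx0⟩ := exists_eval_eq_zero_of_mul_neg haz ha
  obtain ⟨y, hy, hy0⟩ := exists_eval_eq_zero_of_mul_neg hzb hb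
  have hp := ne_zero_of_eval_ne_zero (left_ne_zero_of_mul ha.ne)
  exact Finset.one_lt_card.mpr
    ⟨x, mem_zerosIn.mpr ⟨(mem_roots_toFinset hp).mpr hx0, hx.1, hx.2.trans hzb⟩,
      y, mem_zerosIn.mpr ⟨(mem_roots_toFinset hp).mpr hy0, haz.trans hy.1, hy.2⟩,
      (hx.2.trans hy.1).ne⟩

theorem mul_add_pos_of_abs_lt {u v : ℝ} (h : |v| < |u|) : 0 < u * (u + v) := by
  rcases lt_abs.mp h with hu | hu <;> nlinarith [neg_abs_le v, le_abs_self v, abs_nonneg v]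

theorem mul_neg_of_mul_pos_of_mul_neg {u v w : ℝ} (huv : 0 < u * v) (huw : u * w < 0) :
    v * w < 0 := by
  rcases mul_pos_iff.mp huv with ⟨hu, hv⟩ | ⟨hu, hv⟩
  · exact mul_neg_of_pos_of_neg hv ((pos_iff_neg_of_mul_neg huw).mp hu)
  · exact mul_neg_of_neg_of_pos hv ((neg_iff_pos_of_mul_neg huw).mp hu)

theorem mul_neg_of_abs_lt {x y u v : ℝ} (hx : |u| < |x|) (hy : |v| < |y|) (hxy : x * y < 0) :
    (x + u) * (y + v) < 0 := by
  have hy' : (x + u) * y < 0 := mul_neg_of_mul_pos_of_mul_neg (mul_add_pos_of_abs_lt hx) hxy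
  rw [mul_comm] at hy' ⊢
  exact mul_neg_of_mul_pos_of_mul_neg (mul_add_pos_of_abs_lt hy) hy'

theorem one_le_card_zerosIn_add_of_mul_neg (hab : a < b) (ha : |q.eval a| < |f.eval a|)
    (hb : |q.eval b| < |f.eval b|) (h : f.eval a * f.eval b < 0) :
    1 ≤ #(zerosIn (f + q) (Ioo a b)) :=
  one_le_card_zerosIn_Ioo hab <| by
    rw [eval_add, eval_add]
    exact mul_neg_of_abs_lt ha hb h

theorem two_le_card_zerosIn_add_of_mul_neg (haz : a < z) (hzb : z < b) (hz : f.eval z = 0)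
    (ha : |q.eval a| < |f.eval a|) (hb : |q.eval b| < |f.eval b|)
    (haq : f.eval a * q.eval z < 0) (hbq : f.eval b * q.eval z < 0) :
    2 ≤ #(zerosIn (f + q) (Ioo a b)) := by
  have hz' : (f + q).eval z = q.eval z := by rw [eval_add, hz, zero_add]
  refine two_le_card_zerosIn_Ioo haz hzb ?_ ?_
  · rw [hz', eval_add]
    exact mul_neg_of_mul_pos_of_mul_neg (mul_add_pos_of_abs_lt ha) haq
  · rw [hz', eval_add, mul_comm]
    exact mul_neg_of_mul_pos_of_mul_neg (mul_add_pos_of_abs_lt hb) hbq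

/- If `f` changes sign on `(a, b)`, then so do both `f + q` and `f - q`. Otherwise the one whose
value `± q z` at `z` has the opposite sign crosses zero twice. -/
theorem two_le_card_zerosIn_add_sub (haz : a < z) (hzb : z < b) (hz : f.eval z = 0)
    (ha : |q.eval a| < |f.eval a|) (hb : |q.eval b| < |f.eval b|) :
    2 ≤ #(zerosIn (f + q) (Ioo a b)) + #(zerosIn (f - q) (Ioo a b)) := by
  have ha' : |(-q).eval a| < |f.eval a| := by rwa [eval_neg, abs_neg]
  have hb' : |(-q).eval b| < |f.eval b| := by rwa [eval_neg, abs_neg]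
  have hfa : f.eval a ≠ 0 := abs_pos.mp ((abs_nonneg _).trans_lt ha)
  have hfb : f.eval b ≠ 0 := abs_pos.mp ((abs_nonneg _).trans_lt hb)
  rw [sub_eq_add_neg]
  rcases (mul_ne_zero hfa hfb).lt_or_gt with hab | hab
  · exact add_le_add (one_le_card_zerosIn_add_of_mul_neg (haz.trans hzb) ha hb hab)
      (one_le_card_zerosIn_add_of_mul_neg (haz.trans hzb) ha' hb' hab)
  by_cases hqz : q.eval z = 0
  · have hz' : z ∈ Ioo a b := ⟨haz, hzb⟩
    refine add_le_add (one_le_card_zerosIn (ne_zero_of_eval_ne_zero (x := a) ?_) ?_ hz')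
      (one_le_card_zerosIn (ne_zero_of_eval_ne_zero (x := a) ?_) ?_ hz')
    · exact eval_add.trans_ne (right_ne_zero_of_mul (mul_add_pos_of_abs_lt ha).ne')
    · rw [eval_add, hz, hqz, add_zero]
    · exact eval_add.trans_ne (right_ne_zero_of_mul (mul_add_pos_of_abs_lt ha').ne')
    · rw [eval_add, eval_neg, hz, hqz, neg_zero, add_zero]
  rcases (mul_ne_zero hfa hqz).lt_or_gt with hneg | hpos
  · exact le_add_right (two_le_card_zerosIn_add_of_mul_neg haz hzb hz ha hb hneg
      (mul_neg_of_mul_pos_of_mul_neg hab hneg))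
  · have hneg : f.eval a * (-q).eval z < 0 := by rwa [eval_neg, mul_neg, neg_neg_iff_pos]
    exact le_add_left (two_le_card_zerosIn_add_of_mul_neg haz hzb hz ha' hb' hneg
      (mul_neg_of_mul_pos_of_mul_neg hab hneg))

theorem eventually_pairwiseDisjoint_ball (Z : Finset ℝ) :
    ∀ᶠ δ in 𝓝[>] (0 : ℝ), (Z : Set ℝ).PairwiseDisjoint fun z => Ioo (z - δ) (z + δ) := by
  have key : ∀ z ∈ Z, ∀ w ∈ Z, ∀ᶠ δ in 𝓝[>] (0 : ℝ),
      z ≠ w → Disjoint (Ioo (z - δ) (z + δ)) (Ioo (w - δ) (w + δ)) := by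
    intro z _ w _
    by_cases hzw : z = w
    · exact .of_forall fun _ h => absurd hzw h
    filter_upwards [Ioo_mem_nhdsGT (half_pos (dist_pos.mpr hzw))] with δ hδ _
    rw [← Real.ball_eq_Ioo, ← Real.ball_eq_Ioo]
    exact Metric.ball_disjoint_ball (by linarith [hδ.2])
  have key' := (Finset.eventually_all Z).mpr fun z hz => (Finset.eventually_all Z).mpr (key z hz)
  filter_upwards [key'] with δ hδ z hz w hw
  exact hδ z hz w hw

theorem eventually_eval_sub_ne_zero_and_eval_add_ne_zero (hf : f ≠ 0) (z : ℝ) :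
    ∀ᶠ δ in 𝓝[>] (0 : ℝ), f.eval (z - δ) ≠ 0 ∧ f.eval (z + δ) ≠ 0 := by
  have hroot := eventually_cofinite_not_isRoot hf
  have hle : 𝓝[>] (0 : ℝ) ≤ cofinite := (nhdsGT_le_nhdsNE 0).trans (nhdsNE_le_cofinite 0)
  exact ((sub_right_injective.tendsto_cofinite.eventually hroot).and
    ((add_right_injective z).tendsto_cofinite.eventually hroot)).filter_mono hle

theorem eventually_Ioo_subset (hs : s ∈ 𝓝 z) : ∀ᶠ δ in 𝓝[>] (0 : ℝ), Ioo (z - δ) (z + δ) ⊆ s := by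
  obtain ⟨δ₀, hδ₀, hball⟩ := Metric.mem_nhds_iff.mp hs
  filter_upwards [Ioo_mem_nhdsGT hδ₀] with δ hδ
  rw [← Real.ball_eq_Ioo]
  exact (Metric.ball_subset_ball hδ.2.le).trans hball

theorem eventually_abs_eval_C_mul_lt (q : ℝ[X]) (hf : f.eval x ≠ 0) :
    ∀ᶠ ε in 𝓝 (0 : ℝ), |(C ε * q).eval x| < |f.eval x| := by
  have hcont : Continuous fun ε : ℝ => |(C ε * q).eval x| := by
    simp only [eval_mul, eval_C]
    fun_prop
  refine hcont.continuousAt.eventually_lt_const ?_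
  simpa only [C_0, zero_mul, eval_zero, abs_zero, abs_pos] using hf

theorem eventually_two_mul_card_roots_le (hf : f ≠ 0) (q : ℝ[X])
    (hs : ∀ z, f.eval z = 0 → s ∈ 𝓝 z) :
    ∀ᶠ ε in 𝓝 (0 : ℝ), 2 * #f.roots.toFinset ≤
      #(zerosIn (f + C ε * q) s) + #(zerosIn (f - C ε * q) s) := by
  set Z := f.roots.toFinset
  have hroot {z : ℝ} (hz : z ∈ Z) : f.eval z = 0 := (mem_roots_toFinset hf).mp hz
  obtain ⟨δ, hδ, hdisj, hends, hsub⟩ := (eventually_mem_nhdsWithin.and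
    ((eventually_pairwiseDisjoint_ball Z).and
    (((Finset.eventually_all Z).mpr fun z _ =>
      eventually_eval_sub_ne_zero_and_eval_add_ne_zero hf z).and
    ((Finset.eventually_all Z).mpr fun z hz =>
      eventually_Ioo_subset (hs z (hroot hz)))))).exists
  have hsmall : ∀ᶠ ε in 𝓝 (0 : ℝ), ∀ z ∈ Z, |(C ε * q).eval (z - δ)| < |f.eval (z - δ)| ∧
      |(C ε * q).eval (z + δ)| < |f.eval (z + δ)| :=
    (Finset.eventually_all Z).mpr fun z hz => (eventually_abs_eval_C_mul_lt q (hends z hz).1).and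
      (eventually_abs_eval_C_mul_lt q (hends z hz).2)
  filter_upwards [hsmall] with ε hε
  calc 2 * #Z = ∑ z ∈ Z, 2 := by rw [Finset.sum_const, smul_eq_mul, mul_comm]
    _ ≤ ∑ z ∈ Z, (#(zerosIn (f + C ε * q) (Ioo (z - δ) (z + δ))) +
          #(zerosIn (f - C ε * q) (Ioo (z - δ) (z + δ)))) :=
        Finset.sum_le_sum fun z hz => two_le_card_zerosIn_add_sub (sub_lt_self z hδ)
          (lt_add_of_pos_right z hδ) (hroot hz) (hε z hz).1 (hε z hz).2
    _ ≤ _ := by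
        rw [Finset.sum_add_distrib]
        exact add_le_add (sum_card_zerosIn_le _ hdisj hsub) (sum_card_zerosIn_le _ hdisj hsub)

theorem exists_two_mul_card_roots_le_of_nonneg (hf : f ≠ 0) (hpos : ∀ x, 0 ≤ f.eval x) :
    ∃ ε : ℝ, 2 * #f.roots.toFinset ≤ #(f - C ε).roots.toFinset := by
  obtain ⟨ε, hε, hle⟩ := (eventually_mem_nhdsWithin.and <|
    (eventually_two_mul_card_roots_le hf 1 fun z _ => univ_mem).filter_mono
      (nhdsWithin_le_nhds (s := Ioi 0))).exists
  rw [mul_one] at hle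
  have hnone : #(zerosIn (f + C ε) univ) = 0 := by
    refine Finset.card_eq_zero.mpr (Finset.eq_empty_of_forall_notMem fun x hx => ?_)
    have hx0 := (mem_roots'.mp (Multiset.mem_toFinset.mp (mem_zerosIn.mp hx).1)).2
    rw [IsRoot.def, eval_add, eval_C] at hx0
    exact (add_pos_of_nonneg_of_pos (hpos x) hε).ne' hx0
  rw [hnone, zero_add] at hle
  exact ⟨ε, hle.trans (card_zerosIn_le_card_roots _ _)⟩

theorem one_le_card_zerosIn_add_zerosIn_of_mul_neg (hab : a < b)
    (h : (p * q).eval a * (p * q).eval b < 0) :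
    1 ≤ #(zerosIn p (Ioo a b)) + #(zerosIn q (Ioo a b)) := by
  have hpq := ne_zero_of_eval_ne_zero (left_ne_zero_of_mul h.ne)
  obtain ⟨x, hx, hx0⟩ := exists_eval_eq_zero_of_mul_neg hab h
  rcases mul_eq_zero.mp (eval_mul.symm.trans hx0) with hx0 | hx0
  · exact le_add_right (one_le_card_zerosIn (left_ne_zero_of_mul hpq) hx0 hx)
  · exact le_add_left (one_le_card_zerosIn (right_ne_zero_of_mul hpq) hx0 hx)

theorem eval_add_mul_sub_pos_of_abs_lt (h : |q.eval x| < |f.eval x|) :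
    0 < ((f + q) * (f - q)).eval x := by
  rw [eval_mul, eval_add, eval_sub, ← sq_sub_sq]
  exact sub_pos.mpr (sq_lt_sq.mpr h)

theorem eval_add_mul_sub_neg_of_abs_lt (h : |f.eval x| < |q.eval x|) :
    ((f + q) * (f - q)).eval x < 0 := by
  rw [eval_mul, eval_add, eval_sub, ← sq_sub_sq]
  exact sub_neg.mpr (sq_lt_sq.mpr h)

theorem eventually_cobounded_abs_eval_lt (h : f.degree < q.degree) :
    ∀ᶠ x in Bornology.cobounded ℝ, |f.eval x| < |q.eval x| := by
  have hq : ∀ᶠ x in Bornology.cobounded ℝ, q.eval x ≠ 0 :=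
    (eventually_cofinite_not_isRoot (ne_zero_of_degree_gt h)).filter_mono
      (Bornology.le_cofinite ℝ)
  filter_upwards [(isLittleO_cobounded_of_degree_lt h).bound one_half_pos, hq] with x hx hx0
  rw [Real.norm_eq_abs, Real.norm_eq_abs] at hx
  linarith [abs_pos.mpr hx0]

theorem one_le_card_zerosIn_add_sub_Ioi (hdeg : f.degree < q.degree)
    (h : |q.eval b| < |f.eval b|) :
    1 ≤ #(zerosIn (f + q) (Ioi b)) + #(zerosIn (f - q) (Ioi b)) := by
  obtain ⟨x, hx, hbx⟩ := (((eventually_cobounded_abs_eval_lt hdeg).filter_mono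
    IsOrderBornology.atTop_le_cobounded).and (eventually_gt_atTop b)).exists
  refine (one_le_card_zerosIn_add_zerosIn_of_mul_neg hbx (mul_neg_of_pos_of_neg
    (eval_add_mul_sub_pos_of_abs_lt h) (eval_add_mul_sub_neg_of_abs_lt hx))).trans ?_
  gcongr <;> exact zerosIn_mono _ Ioo_subset_Ioi_self

theorem one_le_card_zerosIn_add_sub_Iio (hdeg : f.degree < q.degree)
    (h : |q.eval a| < |f.eval a|) :
    1 ≤ #(zerosIn (f + q) (Iio a)) + #(zerosIn (f - q) (Iio a)) := by
  obtain ⟨x, hx, hxa⟩ := (((eventually_cobounded_abs_eval_lt hdeg).filter_mono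
    IsOrderBornology.atBot_le_cobounded).and (eventually_lt_atBot a)).exists
  refine (one_le_card_zerosIn_add_zerosIn_of_mul_neg hxa (mul_neg_of_neg_of_pos
    (eval_add_mul_sub_neg_of_abs_lt hx) (eval_add_mul_sub_pos_of_abs_lt h))).trans ?_
  gcongr <;> exact zerosIn_mono _ Ioo_subset_Iio_self

theorem card_zerosIn_Iio_add_Ioo_add_Ioi_le (p : ℝ[X]) (hab : a ≤ b) :
    #(zerosIn p (Iio a)) + #(zerosIn p (Ioo a b)) + #(zerosIn p (Ioi b)) ≤
      #p.roots.toFinset := by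
  have hleft : Disjoint (Iio a) (Ioo a b) :=
    disjoint_left.mpr fun _ hx hx' => hx'.1.not_gt hx
  have hright : Disjoint (Iio a ∪ Ioo a b) (Ioi b) :=
    disjoint_left.mpr fun x hx hbx => hx.elim (fun hx => (hx.trans_le hab).not_gt hbx)
      fun hx => hx.2.not_gt hbx
  calc _ ≤ #(zerosIn p (Iio a ∪ Ioo a b)) + #(zerosIn p (Ioi b)) := by
        gcongr
        exact card_zerosIn_add_le p hleft
    _ ≤ #(zerosIn p (Iio a ∪ Ioo a b ∪ Ioi b)) := card_zerosIn_add_le p hright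
    _ ≤ #p.roots.toFinset := card_zerosIn_le_card_roots _ _

/- Near each zero of `f`, the polynomials `f ± ε X ^ n` have two zeros altogether, and there is one
more beyond each end of an interval containing the zeros of `f`, since `X ^ n` dominates `f` at
`± ∞`. Hence one of the two has at least `#f.roots.toFinset + 1` zeros. -/
theorem exists_card_roots_add_one_le {n : ℕ} (hf : f ≠ 0) (hn : f.natDegree < n) :
    ∃ ε : ℝ, #f.roots.toFinset + 1 ≤ #(f + C ε * X ^ n).roots.toFinset := by
  obtain ⟨b, hb, hroots⟩ : ∃ b > 0, ∀ z, f.eval z = 0 → z ∈ Ioo (-b) b := by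
    obtain ⟨b, hb⟩ := f.roots.toFinset.finite_toSet.isBounded.subset_ball_lt 0 0
    rw [Real.ball_eq_Ioo, zero_sub, zero_add] at hb
    exact ⟨b, hb.1, fun z hz => hb.2 ((mem_roots_toFinset hf).mpr hz)⟩
  have hleft : f.eval (-b) ≠ 0 := fun h => (hroots _ h).1.false
  have hright : f.eval b ≠ 0 := fun h => (hroots _ h).2.false
  obtain ⟨ε, hε, hmid, hεl, hεr⟩ := (eventually_mem_nhdsWithin.and <|
    ((eventually_two_mul_card_roots_le hf (X ^ n) fun z hz => Ioo_mem_nhds (hroots z hz).1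
      (hroots z hz).2).and <| (eventually_abs_eval_C_mul_lt (X ^ n) hleft).and
      (eventually_abs_eval_C_mul_lt (X ^ n) hright)).filter_mono
        (nhdsWithin_le_nhds (s := Ioi 0))).exists
  have hdeg : f.degree < (C ε * X ^ n).degree := by
    rw [degree_C_mul_X_pow n (ne_of_gt hε)]
    exact (natDegree_lt_iff_degree_lt hf).mp hn
  have hl := one_le_card_zerosIn_add_sub_Iio hdeg hεl
  have hr := one_le_card_zerosIn_add_sub_Ioi hdeg hεr
  have hplus := card_zerosIn_Iio_add_Ioo_add_Ioi_le (f + C ε * X ^ n) (neg_le_self hb.le)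
  have hminus := card_zerosIn_Iio_add_Ioo_add_Ioi_le (f - C ε * X ^ n) (neg_le_self hb.le)
  by_cases h : #f.roots.toFinset + 1 ≤ #(f + C ε * X ^ n).roots.toFinset
  · exact ⟨ε, h⟩
  · refine ⟨-ε, ?_⟩
    rw [C_neg, neg_mul, ← sub_eq_add_neg]
    omega

end RealZeros

section GapRing

variable {r : ℕ} {d : Fin r → ℕ} {f : ℝ[X]} {n : ℕ}

theorem X_pow_mem_gapRing_of_coeff_ne_zero (hf : f ∈ gapRing d) :
    ∀ i, f.coeff i ≠ 0 → (X : ℝ[X]) ^ i ∈ gapRing d := by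
  unfold gapRing at hf
  induction hf using Algebra.adjoin_induction with
  | mem f hf =>
    obtain ⟨j, rfl⟩ := hf
    intro i hi
    obtain rfl : i = d j := of_not_not fun h => hi (by rw [coeff_X_pow, if_neg h])
    exact Algebra.subset_adjoin ⟨j, rfl⟩
  | algebraMap a =>
    intro i hi
    obtain rfl : i = 0 := of_not_not fun h => hi (by rw [algebraMap_eq, coeff_C, if_neg h])
    exact one_mem _
  | add f g _ _ hf hg =>
    intro i hi
    by_cases h : f.coeff i = 0
    · exact hg i fun h' => hi (by rw [coeff_add, h, h', add_zero])
    · exact hf i h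
  | mul f g _ _ hf hg =>
    intro i hi
    rw [coeff_mul] at hi
    obtain ⟨⟨a, b⟩, hab, hne⟩ := Finset.exists_ne_zero_of_sum_ne_zero hi
    rw [← Finset.HasAntidiagonal.mem_antidiagonal.mp hab, pow_add]
    exact mul_mem (hf a (left_ne_zero_of_mul hne)) (hg b (right_ne_zero_of_mul hne))

theorem mem_gapRing_iff :
    f ∈ gapRing d ↔ ∀ i, f.coeff i ≠ 0 → (X : ℝ[X]) ^ i ∈ gapRing d := by
  refine ⟨X_pow_mem_gapRing_of_coeff_ne_zero, fun h => ?_⟩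
  rw [f.as_sum_support_C_mul_X_pow]
  refine sum_mem fun i hi => ?_
  rw [← smul_eq_C_mul]
  exact (gapRing d).smul_mem (h i (mem_support_iff.mp hi)) _

theorem mem_gapRingLE_iff : f ∈ gapRingLE d n ↔ f ∈ gapRing d ∧ f.natDegree ≤ n := by
  rw [gapRingLE, Submodule.mem_inf, mem_degreeLE, natDegree_le_iff_degree_le]
  rfl

theorem C_mem_gapRingLE (d : Fin r → ℕ) (n : ℕ) (a : ℝ) : C a ∈ gapRingLE d n :=
  mem_gapRingLE_iff.mpr ⟨(gapRing d).algebraMap_mem a, by rw [natDegree_C]; exact n.zero_le⟩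

theorem X_pow_mem_gapRing (hd : Finset.univ.gcd d = 1) (hn : conductor d ≤ n) :
    (X : ℝ[X]) ^ n ∈ gapRing d :=
  (conductor_isLeast d hd).1 n hn

theorem X_pow_mul_mem_gapRing (hd : Finset.univ.gcd d = 1) (hn : conductor d ≤ n) (q : ℝ[X]) :
    X ^ n * q ∈ gapRing d := by
  refine mem_gapRing_iff.mpr fun i hi => X_pow_mem_gapRing hd (hn.trans ?_)
  by_contra h
  exact hi (by rw [coeff_X_pow_mul', if_neg h])

end GapRing

section DescartesNumber

variable {r : ℕ} {d : Fin r → ℕ} {f : ℝ[X]} {c j n : ℕ}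

theorem ncard_setOf_eval_eq_zero (hf : f ≠ 0) :
    {x : ℝ | f.eval x = 0}.ncard = #f.roots.toFinset := by
  rw [← ncard_coe_finset]
  congr 1
  ext x
  exact (mem_roots_toFinset hf).symm

theorem card_roots_le_descartesNumber (hf : f ∈ gapRingLE d n) (hf0 : f ≠ 0) :
    #f.roots.toFinset ≤ descartesNumber d n :=
  (descartesNumber_isGreatest d n).2 ⟨f, hf, hf0, ncard_setOf_eval_eq_zero hf0⟩

theorem exists_card_roots_eq_descartesNumber (d : Fin r → ℕ) (n : ℕ) :
    ∃ f ∈ gapRingLE d n, f ≠ 0 ∧ #f.roots.toFinset = descartesNumber d n := by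
  obtain ⟨f, hf, hf0, hcard⟩ := (descartesNumber_isGreatest d n).1
  exact ⟨f, hf, hf0, (ncard_setOf_eval_eq_zero hf0).symm.trans hcard⟩

theorem card_roots_toFinset_le_natDegree (f : ℝ[X]) : #f.roots.toFinset ≤ f.natDegree :=
  (Multiset.toFinset_card_le _).trans (card_roots' f)

theorem descartesNumber_le_self (d : Fin r → ℕ) (n : ℕ) : descartesNumber d n ≤ n := by
  obtain ⟨f, hf, -, hcard⟩ := exists_card_roots_eq_descartesNumber d n
  exact hcard ▸ (card_roots_toFinset_le_natDegree f).trans (mem_gapRingLE_iff.mp hf).2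

theorem descartesNumber_add_one_le (h : (X : ℝ[X]) ^ (n + 1) ∈ gapRing d) :
    descartesNumber d n + 1 ≤ descartesNumber d (n + 1) := by
  obtain ⟨f, hf, hf0, hcard⟩ := exists_card_roots_eq_descartesNumber d n
  obtain ⟨hfR, hfn⟩ := mem_gapRingLE_iff.mp hf
  obtain ⟨ε, hε⟩ := exists_card_roots_add_one_le hf0 (Nat.lt_succ_of_le hfn)
  have hmem : f + C ε * X ^ (n + 1) ∈ gapRingLE d (n + 1) := by
    rw [← smul_eq_C_mul]
    refine mem_gapRingLE_iff.mpr ⟨add_mem hfR ((gapRing d).smul_mem h ε), ?_⟩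
    exact natDegree_add_le_of_degree_le (hfn.trans n.le_succ)
      ((natDegree_smul_le _ _).trans (natDegree_X_pow_le _))
  have hne : f + C ε * X ^ (n + 1) ≠ 0 := by
    intro h0
    rw [h0, roots_zero, Multiset.toFinset_zero, Finset.card_empty] at hε
    omega
  exact hcard ▸ hε.trans (card_roots_le_descartesNumber hmem hne)

theorem descartesNumber_conductor_add_le (hd : Finset.univ.gcd d = 1) (hn : conductor d ≤ n) :
    descartesNumber d (conductor d) + (n - conductor d) ≤ descartesNumber d n := by
  induction n, hn using Nat.le_induction with
  | base => rw [Nat.sub_self, add_zero]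
  | succ n hn ih =>
    have := descartesNumber_add_one_le (X_pow_mem_gapRing hd (hn.trans n.le_succ))
    omega

theorem two_mul_card_roots_le_descartesNumber (hf : f ∈ gapRingLE d n) (hf0 : f ≠ 0)
    (hpos : ∀ x, 0 ≤ f.eval x) : 2 * #f.roots.toFinset ≤ descartesNumber d n := by
  obtain ⟨ε, hle⟩ := exists_two_mul_card_roots_le_of_nonneg hf0 hpos
  refine hle.trans ?_
  by_cases h : f - C ε = 0
  · rw [h, roots_zero, Multiset.toFinset_zero, Finset.card_empty]
    exact Nat.zero_le _
  · exact card_roots_le_descartesNumber (sub_mem hf (C_mem_gapRingLE d n ε)) h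

/-- For `f` of degree at most `c + j`, the reciprocal polynomial (with respect to degree `c`) of
the `j`-th derivative of the reciprocal polynomial of `f` (with respect to degree `c + j`). It
lowers the degree to `c` without creating new exponents, and loses at most `j + 1` real zeros. -/
def reciprocalDerivative (c j : ℕ) (f : ℝ[X]) : ℝ[X] :=
  reflect c (derivative^[j] (reflect (c + j) f))

theorem coeff_reciprocalDerivative (hf : f.natDegree ≤ c + j) (i : ℕ) :
    (reciprocalDerivative c j f).coeff i =
      if i ≤ c then ((c + j - i).descFactorial j : ℝ) * f.coeff i else 0 := by
  rw [reciprocalDerivative, coeff_reflect, coeff_iterate_derivative, coeff_reflect, nsmul_eq_mul]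
  split_ifs with hi
  · rw [revAt_le hi, show c - i + j = c + j - i by omega, revAt_le (by omega),
      show c + j - (c + j - i) = i by omega]
  · rw [revAt_eq_self_of_lt (by omega), revAt_eq_self_of_lt (by omega),
      coeff_eq_zero_of_natDegree_lt (by omega), mul_zero]

theorem reciprocalDerivative_mem_gapRingLE (hf : f ∈ gapRingLE d (c + j)) :
    reciprocalDerivative c j f ∈ gapRingLE d c := by
  obtain ⟨hfR, hfn⟩ := mem_gapRingLE_iff.mp hf
  refine mem_gapRingLE_iff.mpr ⟨mem_gapRing_iff.mpr fun i hi => mem_gapRing_iff.mp hfR i fun h =>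
    hi ?_, natDegree_le_iff_coeff_eq_zero.mpr fun i hi => ?_⟩
  · rw [coeff_reciprocalDerivative hfn, h, mul_zero, ite_self]
  · rw [coeff_reciprocalDerivative hfn, if_neg (by omega)]

theorem X_pow_dvd_of_reciprocalDerivative_eq_zero (hf : f.natDegree ≤ c + j)
    (h : reciprocalDerivative c j f = 0) : X ^ (c + 1) ∣ f := by
  refine X_pow_dvd_iff.mpr fun i hi => ?_
  have hcoeff := coeff_reciprocalDerivative hf i
  rw [h, coeff_zero, if_pos (by omega), zero_eq_mul] at hcoeff
  refine hcoeff.resolve_left ?_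
  exact_mod_cast (Nat.descFactorial_pos.mpr (by omega)).ne'

theorem card_roots_add_le_of_X_pow_dvd (hf : f ≠ 0) (h : X ^ n ∣ f) :
    #f.roots.toFinset + n ≤ f.natDegree + 1 := by
  obtain ⟨q, rfl⟩ := h
  have hq : q ≠ 0 := right_ne_zero_of_mul hf
  have hsub : (X ^ n * q).roots.toFinset ⊆ insert 0 q.roots.toFinset := by
    intro x hx
    rw [mem_roots_toFinset hf, eval_mul, eval_pow, eval_X, mul_eq_zero] at hx
    rw [Finset.mem_insert, mem_roots_toFinset hq]
    exact hx.imp_left eq_zero_of_pow_eq_zero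
  have hcard := (Finset.card_le_card hsub).trans (Finset.card_insert_le _ _)
  have hle := card_roots_toFinset_le_natDegree q
  rw [natDegree_X_pow_mul _ hq]
  omega

theorem card_roots_erase_zero_le_reflect (hf : f ≠ 0) (hn : f.natDegree ≤ n) :
    #(f.roots.toFinset.erase 0) ≤ #((reflect n f).roots.toFinset.erase 0) := by
  refine Finset.card_le_card_of_injOn (·⁻¹) (fun x hx => ?_) inv_injective.injOn
  rw [Finset.mem_coe, Finset.mem_erase, mem_roots_toFinset hf] at hx
  have : Invertible x := invertibleOfNonzero hx.1
  have hinv := (eval₂_reflect_eq_zero_iff (RingHom.id ℝ) x n f hn).mpr hx.2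
  rw [Finset.mem_coe, Finset.mem_erase, mem_roots_toFinset (reflect_eq_zero_iff.not.mpr hf)]
  exact ⟨inv_ne_zero hx.1, by rwa [invOf_eq_inv] at hinv⟩

theorem card_roots_le_iterate_derivative (f : ℝ[X]) (j : ℕ) :
    #f.roots.toFinset ≤ #(derivative^[j] f).roots.toFinset + j := by
  induction j with
  | zero => rfl
  | succ j ih =>
    rw [Function.iterate_succ_apply']
    have := card_roots_toFinset_le_derivative (derivative^[j] f)
    omega

theorem card_roots_erase_zero_le_reciprocalDerivative (hf : f.natDegree ≤ c + j)
    (h0 : reciprocalDerivative c j f ≠ 0) :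
    #(f.roots.toFinset.erase 0) ≤
      #((reciprocalDerivative c j f).roots.toFinset.erase 0) + j + 1 := by
  set h := reflect (c + j) f
  have hderiv : derivative^[j] h ≠ 0 := reflect_eq_zero_iff.not.mp h0
  have hh : h ≠ 0 := fun hh => hderiv (by rw [hh, iterate_derivative_zero])
  have hn : (derivative^[j] h).natDegree ≤ c := by
    have hle := natDegree_iterate_derivative h j
    have hle' : h.natDegree ≤ max (c + j) f.natDegree := natDegree_reflect_le
    omega
  calc #(f.roots.toFinset.erase 0)
      ≤ #h.roots.toFinset := (card_roots_erase_zero_le_reflect (reflect_eq_zero_iff.not.mp hh)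
        hf).trans Finset.card_erase_le
    _ ≤ #(derivative^[j] h).roots.toFinset + j := card_roots_le_iterate_derivative h j
    _ ≤ #((derivative^[j] h).roots.toFinset.erase 0) + 1 + j :=
      add_le_add_left (Nat.le_add_of_sub_le Finset.pred_card_le_card_erase) j
    _ ≤ _ := by
      rw [add_right_comm, add_assoc, add_assoc]
      exact add_le_add_left (card_roots_erase_zero_le_reflect hderiv hn) (j + 1)

theorem card_roots_le_reciprocalDerivative (hf0 : f ≠ 0) (hf : f.natDegree ≤ c + j)
    (h0 : reciprocalDerivative c j f ≠ 0) :
    #f.roots.toFinset ≤ #(reciprocalDerivative c j f).roots.toFinset + j + 1 := by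
  have hle := card_roots_erase_zero_le_reciprocalDerivative hf h0
  by_cases hz : (0 : ℝ) ∈ f.roots.toFinset
  · have hz' : (0 : ℝ) ∈ (reciprocalDerivative c j f).roots.toFinset := by
      rw [mem_roots_toFinset hf0, ← coeff_zero_eq_eval_zero] at hz
      rw [mem_roots_toFinset h0, ← coeff_zero_eq_eval_zero, coeff_reciprocalDerivative hf, hz,
        mul_zero, ite_self]
    have := Finset.card_erase_add_one hz
    have := Finset.card_erase_add_one hz'
    omega
  · rw [Finset.erase_eq_of_notMem hz] at hle
    exact hle.trans (by gcongr; exact Finset.erase_subset _ _)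

theorem descartesNumber_le_add (d : Fin r → ℕ) (c j : ℕ) :
    descartesNumber d (c + j) ≤ descartesNumber d c + j + 1 := by
  obtain ⟨f, hf, hf0, hcard⟩ := exists_card_roots_eq_descartesNumber d (c + j)
  have hfn := (mem_gapRingLE_iff.mp hf).2
  rw [← hcard]
  by_cases h0 : reciprocalDerivative c j f = 0
  · have := card_roots_add_le_of_X_pow_dvd hf0 (X_pow_dvd_of_reciprocalDerivative_eq_zero hfn h0)
    omega
  · have hle := card_roots_le_descartesNumber (reciprocalDerivative_mem_gapRingLE hf) h0
    exact (card_roots_le_reciprocalDerivative hf0 hfn h0).trans (by gcongr)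

end DescartesNumber

section Interpolation

/-- `V` interpolates `Z` if arbitrary values on `Z` are attained by an element of `V`, i.e. if the
point evaluations of `V` at the points of `Z` are linearly independent. -/
def Interpolates (V : Submodule ℝ ℝ[X]) (Z : Finset ℝ) : Prop :=
  ∀ v : ℝ → ℝ, ∃ f ∈ V, ∀ z ∈ Z, f.eval z = v z

/- A polynomial with constant term `v 0` that takes the remaining values is `v 0 + X ^ k * q`, and
multiples of `X ^ k` lie in the ring. -/
theorem interpolates_gapRingLE {r : ℕ} {d : Fin r → ℕ} (hd : Finset.univ.gcd d = 1) {k : ℕ}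
    (hk : conductor d ≤ k) {Z : Finset ℝ} (hZ : #Z ≤ k) : Interpolates (gapRingLE d (2 * k)) Z := by
  intro v
  set q := Lagrange.interpolate Z id fun z => (v z - v 0) / z ^ k
  have hqk : q.natDegree ≤ k := natDegree_le_of_degree_le <|
    (Lagrange.degree_interpolate_lt _ (injOn_id _)).le.trans (Nat.cast_le.mpr hZ)
  have hmem : X ^ k * q ∈ gapRingLE d (2 * k) := by
    refine mem_gapRingLE_iff.mpr ⟨X_pow_mul_mem_gapRing hd hk q, natDegree_mul_le.trans ?_⟩
    rw [natDegree_X_pow, two_mul]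
    exact Nat.add_le_add_left hqk k
  refine ⟨C (v 0) + X ^ k * q, add_mem (C_mem_gapRingLE d _ _) hmem, fun z hz => ?_⟩
  have hqz : q.eval z = (v z - v 0) / z ^ k :=
    Lagrange.eval_interpolate_at_node (v := id) _ (injOn_id _) hz
  rw [eval_add, eval_C, eval_mul, eval_pow, eval_X, hqz]
  rcases eq_or_ne z 0 with rfl | hz0
  · have hk0 : k ≠ 0 := ((Finset.card_pos.mpr ⟨_, hz⟩).trans_le hZ).ne'
    rw [zero_pow hk0, zero_mul, add_zero]
  · rw [mul_div_cancel₀ _ (pow_ne_zero k hz0), add_sub_cancel]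

end Interpolation

section ConicCombination

variable {V : Submodule ℝ ℝ[X]} {L : V →ₗ[ℝ] ℝ} {Z : Finset ℝ} {n : ℕ}

theorem pointEval_apply (x : ℝ) (f : V) : pointEval V x f = (f : ℝ[X]).eval x := rfl

theorem isConicCombination_sum {w : ℝ → ℝ} (hw : ∀ z ∈ Z, 0 ≤ w z) :
    IsConicCombination (∑ z ∈ Z, w z • pointEval V z) #Z := by
  refine ⟨fun i => Z.equivFin.symm i, fun i => w (Z.equivFin.symm i),
    fun i => hw _ (Z.equivFin.symm i).2, ?_⟩
  rw [← Finset.sum_coe_sort]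
  exact (Equiv.sum_comp Z.equivFin.symm fun z : Z => w z • pointEval V z).symm

theorem IsConicCombination.add_smul_pointEval (hL : IsConicCombination L n) {a : ℝ} (ha : 0 ≤ a)
    (x : ℝ) : IsConicCombination (L + a • pointEval V x) (n + 1) := by
  obtain ⟨y, b, hb, rfl⟩ := hL
  refine ⟨Fin.snoc y x, Fin.snoc b a, fun i => ?_, ?_⟩
  · refine Fin.lastCases ?_ (fun i => ?_) i
    · rwa [Fin.snoc_last]
    · rw [Fin.snoc_castSucc]
      exact hb i
  · simp only [Fin.sum_univ_castSucc, Fin.snoc_castSucc, Fin.snoc_last]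

theorem Interpolates.exists_dual (hZ : Interpolates V Z) :
    ∃ e : ℝ → V, ∀ y, ∀ z ∈ Z, (e y : ℝ[X]).eval z = if z = y then 1 else 0 := by
  choose e he hez using fun y => hZ fun z => if z = y then 1 else 0
  exact ⟨fun y => ⟨e y, he y⟩, hez⟩

theorem apply_eq_of_eval_eq (hL : ∀ g : V, (∀ z ∈ Z, 0 ≤ (g : ℝ[X]).eval z) → 0 ≤ L g) {f g : V}
    (hfg : ∀ z ∈ Z, (f : ℝ[X]).eval z = (g : ℝ[X]).eval z) : L f = L g := by
  have hle {f g : V} (hfg : ∀ z ∈ Z, (f : ℝ[X]).eval z = (g : ℝ[X]).eval z) : L f ≤ L g := by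
    rw [← sub_nonneg, ← map_sub]
    exact hL _ fun z hz => by rw [Submodule.coe_sub, eval_sub, hfg z hz, sub_self]
  exact (hle hfg).antisymm (hle fun z hz => (hfg z hz).symm)

theorem isConicCombination_of_nonneg_on (hZ : Interpolates V Z)
    (hL : ∀ g : V, (∀ z ∈ Z, 0 ≤ (g : ℝ[X]).eval z) → 0 ≤ L g) : IsConicCombination L #Z := by
  obtain ⟨e, he⟩ := hZ.exists_dual
  have hw : ∀ y ∈ Z, 0 ≤ L (e y) := fun y _ => hL _ fun z hz => by
    rw [he y z hz]
    split_ifs <;> positivity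
  convert isConicCombination_sum (V := V) hw
  ext g
  have heval : ∀ z ∈ Z, (g : ℝ[X]).eval z =
      ((∑ y ∈ Z, (g : ℝ[X]).eval y • e y : V) : ℝ[X]).eval z := by
    intro z hz
    simp only [Submodule.coe_sum, Submodule.coe_smul, eval_finsetSum, eval_smul, smul_eq_mul,
      he _ z hz, mul_ite, mul_one, mul_zero, Finset.sum_ite_eq, if_pos hz]
  rw [apply_eq_of_eval_eq hL heval, map_sum, LinearMap.sum_apply]
  exact Finset.sum_congr rfl fun y _ => by
    rw [map_smul, LinearMap.smul_apply, pointEval_apply, smul_eq_mul, smul_eq_mul, mul_comm]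

theorem isMomentFunctional_sum_pointEval (V : Submodule ℝ ℝ[X]) (Z : Finset ℝ) :
    IsMomentFunctional (∑ z ∈ Z, pointEval V z) := by
  refine ⟨∑ z ∈ Z, Measure.dirac z, fun f => ?_⟩
  have hint : ∀ z ∈ Z, Integrable (fun x => (f : ℝ[X]).eval x) (Measure.dirac z) :=
    fun z _ => integrable_dirac enorm_lt_top
  refine ⟨integrable_finsetSum_measure.mpr hint, ?_⟩
  rw [integral_finsetSum_measure hint, LinearMap.sum_apply]
  exact Finset.sum_congr rfl fun z _ => by rw [integral_dirac, pointEval_apply]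

/- Evaluating at `q` shows that the atoms with nonzero weight are zeros of `q`; evaluating at the
dual polynomials then shows that every zero of `q` carries an atom. -/
theorem card_le_of_isConicCombination_sum (hZ : Interpolates V Z) {q : V}
    (hq : ∀ x, 0 ≤ (q : ℝ[X]).eval x) (hqZ : ∀ x, (q : ℝ[X]).eval x = 0 ↔ x ∈ Z)
    (hn : IsConicCombination (∑ z ∈ Z, pointEval V z) n) : #Z ≤ n := by
  obtain ⟨x, a, ha, hL⟩ := hn
  have happ (f : V) : ∑ z ∈ Z, (f : ℝ[X]).eval z = ∑ i, a i * (f : ℝ[X]).eval (x i) := by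
    simpa only [LinearMap.sum_apply, LinearMap.smul_apply, pointEval_apply, smul_eq_mul] using
      LinearMap.congr_fun hL f
  have hatom : ∀ i, a i ≠ 0 → x i ∈ Z := by
    have hsum : ∑ i, a i * (q : ℝ[X]).eval (x i) = 0 := by
      rw [← happ, Finset.sum_eq_zero fun z hz => (hqZ z).mpr hz]
    intro i hi
    have hzero := (Finset.sum_eq_zero_iff_of_nonneg fun i _ => mul_nonneg (ha i) (hq _)).mp hsum i
      (Finset.mem_univ i)
    exact (hqZ _).mp ((mul_eq_zero.mp hzero).resolve_left hi)
  obtain ⟨e, he⟩ := hZ.exists_dual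
  have hsub : Z ⊆ Finset.univ.image x := by
    intro z hz
    have hone : ∑ i, a i * (e z : ℝ[X]).eval (x i) = 1 := by
      rw [← happ, Finset.sum_congr rfl (he z), Finset.sum_ite_eq', if_pos hz]
    obtain ⟨i, -, hi⟩ := Finset.exists_ne_zero_of_sum_ne_zero (hone.trans_ne one_ne_zero)
    rw [he z _ (hatom i (left_ne_zero_of_mul hi))] at hi
    refine Finset.mem_image.mpr ⟨i, Finset.mem_univ i, of_not_not fun hne => hi ?_⟩
    rw [if_neg hne, mul_zero]
  simpa only [Finset.card_fin] using (Finset.card_le_card hsub).trans Finset.card_image_le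

end ConicCombination

section ExtremalElements

variable {E : Type*}

theorem isCompact_inter_level [NormedAddCommGroup E] [NormedSpace ℝ E] [ProperSpace E]
    {K : Set E} (hK : IsClosed K) (hcone : ∀ g ∈ K, ∀ a : ℝ, 0 < a → a • g ∈ K) {L : E →L[ℝ] ℝ}
    (hL : ∀ g ∈ K, g ≠ 0 → 0 < L g) : IsCompact {g ∈ K | L g = 1} := by
  have hclosed : IsClosed {g ∈ K | L g = 1} := hK.inter (isClosed_eq L.continuous continuous_const)
  obtain ⟨m, hm, hmin⟩ : ∃ m > 0, ∀ g ∈ K ∩ Metric.sphere 0 1, m ≤ L g :=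
    ((isCompact_sphere (0 : E) 1).inter_left hK).exists_forall_le' L.continuous.continuousOn
      fun g hg => hL g hg.1 (ne_zero_of_mem_unit_sphere ⟨g, hg.2⟩)
  refine Metric.isCompact_of_isClosed_isBounded hclosed
    (Metric.isBounded_closedBall (x := 0) (r := m⁻¹) |>.subset fun g ⟨hg, hg1⟩ => ?_)
  have hg0 : 0 < ‖g‖ := norm_pos_iff.mpr fun h => zero_ne_one (by rw [← hg1, h, map_zero])
  have hle := hmin (‖g‖⁻¹ • g) ⟨hcone g hg _ (inv_pos.mpr hg0), by
    rw [mem_sphere_zero_iff_norm, norm_smul, norm_inv, norm_norm, inv_mul_cancel₀ hg0.ne']⟩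
  rw [map_smul, hg1, smul_eq_mul, mul_one] at hle
  rw [mem_closedBall_zero_iff]
  exact (le_inv_comm₀ hm hg0).mp hle

/- The supremum of `|ℓ|` over the compact base `{g ∈ K | L g = 1}` of the cone `K` is attained. -/
theorem exists_abs_le_abs_mul_of_isClosed [NormedAddCommGroup E] [NormedSpace ℝ E]
    [FiniteDimensional ℝ E] {K : Set E} (hK : IsClosed K)
    (hcone : ∀ g ∈ K, ∀ a : ℝ, 0 < a → a • g ∈ K) {L : E →ₗ[ℝ] ℝ}
    (hL : ∀ g ∈ K, g ≠ 0 → 0 < L g) {g₀ : E} (hg₀ : g₀ ∈ K) (hne : g₀ ≠ 0) (ℓ : E →ₗ[ℝ] ℝ) :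
    ∃ f ∈ K, L f = 1 ∧ ∀ g ∈ K, |ℓ g| ≤ |ℓ f| * L g := by
  have := FiniteDimensional.proper_real E
  have hnormalize : ∀ g ∈ K, g ≠ 0 → (L g)⁻¹ • g ∈ {g ∈ K | L g = 1} := fun g hg hg0 =>
    ⟨hcone g hg _ (inv_pos.mpr (hL g hg hg0)), by
      rw [map_smul, smul_eq_mul, inv_mul_cancel₀ (hL g hg hg0).ne']⟩
  obtain ⟨f, ⟨hf, hf1⟩, hmax⟩ := (isCompact_inter_level (L := L.toContinuousLinearMap) hK hcone
    hL).exists_isMaxOn ⟨_, hnormalize g₀ hg₀ hne⟩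
      (ℓ.continuous_of_finiteDimensional.abs.continuousOn)
  refine ⟨f, hf, hf1, fun g hg => ?_⟩
  rcases eq_or_ne g 0 with rfl | hg0
  · rw [map_zero, map_zero, abs_zero, mul_zero]
  · have hle : |ℓ ((L g)⁻¹ • g)| ≤ |ℓ f| := hmax (hnormalize g hg hg0)
    rwa [map_smul, smul_eq_mul, abs_mul, abs_inv, abs_of_pos (hL g hg hg0), inv_mul_le_iff₀
      (hL g hg hg0), mul_comm] at hle

theorem exists_abs_le_abs_mul [AddCommGroup E] [Module ℝ E] [FiniteDimensional ℝ E] {ι : Type*}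
    {e : ι → E →ₗ[ℝ] ℝ} {L : E →ₗ[ℝ] ℝ} (hL : ∀ g, (∀ i, 0 ≤ e i g) → g ≠ 0 → 0 < L g) {g₀ : E}
    (hg₀ : ∀ i, 0 ≤ e i g₀) (hne : g₀ ≠ 0) (ℓ : E →ₗ[ℝ] ℝ) :
    ∃ f, (∀ i, 0 ≤ e i f) ∧ L f = 1 ∧ ∀ g, (∀ i, 0 ≤ e i g) → |ℓ g| ≤ |ℓ f| * L g := by
  let φ := (Module.finBasis ℝ E).equivFun
  let ψ := φ.symm.toLinearMap
  have hψφ (g : E) : ψ (φ g) = g := φ.symm_apply_apply g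
  have hclosed : IsClosed {v | ∀ i, 0 ≤ e i (ψ v)} := by
    simp only [ofPred_forall]
    exact isClosed_iInter fun i => isClosed_le continuous_const
      (e i ∘ₗ ψ).continuous_of_finiteDimensional
  have hcone : ∀ v ∈ {v | ∀ i, 0 ≤ e i (ψ v)}, ∀ a : ℝ, 0 < a →
      a • v ∈ {v | ∀ i, 0 ≤ e i (ψ v)} := fun v hv a ha i => by
    rw [map_smul, map_smul, smul_eq_mul]
    exact mul_nonneg ha.le (hv i)
  obtain ⟨v, hv, hv1, hmax⟩ := exists_abs_le_abs_mul_of_isClosed (L := L ∘ₗ ψ) hclosed hcone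
    (fun v hv hv0 => hL _ hv (φ.symm.map_ne_zero_iff.mpr hv0)) (g₀ := φ g₀)
    (fun i => (hψφ g₀).symm ▸ hg₀ i) (φ.map_ne_zero_iff.mpr hne) (ℓ ∘ₗ ψ)
  refine ⟨ψ v, hv, hv1, fun g hg => ?_⟩
  simpa only [LinearMap.comp_apply, hψφ] using hmax (φ g) fun i => (hψφ g).symm ▸ hg i

end ExtremalElements

section PositiveFunctionals

variable {f g : ℝ[X]} {V : Submodule ℝ ℝ[X]} {L : V →ₗ[ℝ] ℝ} {n : ℕ}

/- Near infinity `g` is bounded by a multiple of `f`. The rest of `{x | g x + δ ≤ 0}` is compact,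
and `f` is positive there. -/
theorem exists_nonneg_add_mul (hf : ∀ x, 0 ≤ f.eval x) (hdeg : g.degree ≤ f.degree)
    (hfg : ∀ x, f.eval x = 0 → 0 ≤ g.eval x) {δ : ℝ} (hδ : 0 < δ) :
    ∃ c, ∀ x, 0 ≤ g.eval x + δ + c * f.eval x := by
  obtain ⟨C, hC⟩ := (isBigO_cobounded_of_degree_le hdeg).bound
  rw [Metric.cobounded_eq_cocompact] at hC
  obtain ⟨K, hK, hKC⟩ := mem_cocompact.mp hC
  have hne : ∀ x ∈ K ∩ {x | g.eval x + δ ≤ 0}, f.eval x ≠ 0 := fun x hx hfx =>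
    (add_pos_of_nonneg_of_pos (hfg x hfx) hδ).not_ge hx.2
  obtain ⟨B, hB⟩ : BddAbove ((fun x => -(g.eval x + δ) / f.eval x) ''
      (K ∩ {x | g.eval x + δ ≤ 0})) :=
    (hK.inter_right (isClosed_le (by fun_prop) continuous_const)).bddAbove_image
      (ContinuousOn.div (by fun_prop) (by fun_prop) hne)
  refine ⟨max (max C B) 0, fun x => ?_⟩
  suffices -(g.eval x + δ) ≤ max (max C B) 0 * f.eval x by linarith
  by_cases hgx : g.eval x + δ ≤ 0
  · by_cases hx : x ∈ K
    · calc -(g.eval x + δ) ≤ B * f.eval x :=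
            (div_le_iff₀ ((hf x).lt_of_ne' (hne x ⟨hx, hgx⟩))).mp
              (hB (mem_image_of_mem _ ⟨hx, hgx⟩))
        _ ≤ _ := mul_le_mul_of_nonneg_right (le_max_of_le_left (le_max_right C B)) (hf x)
    · have hle : |g.eval x| ≤ C * |f.eval x| := hKC hx
      rw [abs_of_nonneg (hf x)] at hle
      calc -(g.eval x + δ) ≤ |g.eval x| := by linarith [neg_le_abs (g.eval x)]
        _ ≤ C * f.eval x := hle
        _ ≤ _ := mul_le_mul_of_nonneg_right (le_max_of_le_left (le_max_left C B)) (hf x)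
  · exact (neg_neg_of_pos (not_le.mp hgx)).le.trans (mul_nonneg (le_max_right _ _) (hf x))

theorem nonneg_of_nonneg_on_zeros (h1 : 1 ∈ V)
    (hL : ∀ g : V, (∀ x, 0 ≤ (g : ℝ[X]).eval x) → 0 ≤ L g) {f g : V}
    (hf : ∀ x, 0 ≤ (f : ℝ[X]).eval x) (hLf : L f = 0)
    (hdeg : (g : ℝ[X]).degree ≤ (f : ℝ[X]).degree)
    (hfg : ∀ x, (f : ℝ[X]).eval x = 0 → 0 ≤ (g : ℝ[X]).eval x) : 0 ≤ L g := by
  have hL1 : 0 ≤ L ⟨1, h1⟩ := hL _ fun x => by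
    rw [eval_one]
    exact zero_le_one
  refine le_of_forall_pos_le_add fun ε hε => ?_
  obtain ⟨c, hc⟩ := exists_nonneg_add_mul hf hdeg hfg (div_pos hε (add_pos_of_nonneg_of_pos hL1
    one_pos))
  have hle := hL (g + (ε / (L ⟨1, h1⟩ + 1)) • ⟨1, h1⟩ + c • f) fun x => by
    simpa only [Submodule.coe_add, Submodule.coe_smul, eval_add, eval_smul, eval_one, smul_eq_mul,
      mul_one] using hc x
  rw [map_add, map_add, map_smul, map_smul, hLf, smul_zero, add_zero, smul_eq_mul,
    div_mul_eq_mul_div] at hle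
  refine hle.trans (add_le_add_right ((div_le_iff₀ (by positivity)).mpr ?_) _)
  exact mul_le_mul_of_nonneg_left (le_add_of_nonneg_right zero_le_one) hε.le

theorem IsMomentFunctional.nonneg (hL : IsMomentFunctional L) {g : V}
    (hg : ∀ x, 0 ≤ (g : ℝ[X]).eval x) : 0 ≤ L g := by
  obtain ⟨μ, hμ⟩ := hL
  exact (integral_nonneg hg).trans_eq (hμ g).2.symm

theorem IsMomentFunctional.nonneg_of_nonneg_on_zeros (hL : IsMomentFunctional L) {f g : V}
    (hf : ∀ x, 0 ≤ (f : ℝ[X]).eval x) (hLf : L f = 0)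
    (hfg : ∀ x, (f : ℝ[X]).eval x = 0 → 0 ≤ (g : ℝ[X]).eval x) : 0 ≤ L g := by
  obtain ⟨μ, hμ⟩ := hL
  rw [(hμ f).2, integral_eq_zero_iff_of_nonneg hf (hμ f).1] at hLf
  exact (integral_nonneg_of_ae (hLf.mono hfg)).trans_eq (hμ g).2.symm

theorem finiteDimensional_of_le_degreeLE (hV : V ≤ degreeLE ℝ n) : FiniteDimensional ℝ V := by
  have : FiniteDimensional ℝ (degreeLE ℝ (n : WithBot ℕ)) := by
    rw [degreeLE_eq_span_X_pow]
    exact FiniteDimensional.span_finset ℝ _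
  exact Submodule.finiteDimensional_of_le hV

theorem exists_abs_coeff_le (hV : V ≤ degreeLE ℝ n)
    (hL : ∀ g : V, (∀ x, 0 ≤ (g : ℝ[X]).eval x) → g ≠ 0 → 0 < L g) {g₀ : V}
    (hg₀ : ∀ x, 0 ≤ (g₀ : ℝ[X]).eval x) (hne : g₀ ≠ 0) :
    ∃ c : ℕ → ℝ, ∀ i, ∀ g : V, (∀ x, 0 ≤ (g : ℝ[X]).eval x) →
      |(g : ℝ[X]).coeff i| ≤ c i * L g := by
  have := finiteDimensional_of_le_degreeLE hV
  choose f _ _ hmax using fun i =>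
    exists_abs_le_abs_mul (e := pointEval V) hL hg₀ hne (lcoeff ℝ i ∘ₗ V.subtype)
  exact ⟨fun i => |(f i : ℝ[X]).coeff i|, hmax⟩

theorem eventually_sum_mul_pow_lt (c : ℕ → ℝ) (n : ℕ) :
    ∀ᶠ x in atTop, ∑ i ∈ Finset.range n, c i * x ^ i < x ^ n := by
  have hdeg : (∑ i : Fin n, C (c i) * X ^ (i : ℕ)).degree < (X ^ n : ℝ[X]).degree := by
    rw [degree_X_pow]
    exact degree_sum_fin_lt fun i : Fin n => c i
  filter_upwards [(eventually_cobounded_abs_eval_lt hdeg).filter_mono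
    IsOrderBornology.atTop_le_cobounded, eventually_ge_atTop 0] with x hx hx0
  rw [eval_pow, eval_X, abs_of_nonneg (pow_nonneg hx0 n), eval_finsetSum] at hx
  simp only [eval_mul, eval_C, eval_pow, eval_X] at hx
  rw [← Fin.sum_univ_eq_sum_range fun i => c i * x ^ i]
  exact (le_abs_self _).trans_lt hx

/- With `L f = 1`, nonnegative elements of degree less than `n` are too small at points `x` near
infinity to compete with `X ^ n`, so the element of the base maximizing the evaluation at such an
`x` has degree `n`. -/
theorem exists_coeff_ne_zero_and_mul_eval_le (hV : V ≤ degreeLE ℝ n) (hX : X ^ n ∈ V)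
    (hn : Even n) (hL : ∀ g : V, (∀ x, 0 ≤ (g : ℝ[X]).eval x) → g ≠ 0 → 0 < L g) :
    ∃ a ≥ 0, ∃ x : ℝ, ∃ f : V, (∀ y, 0 ≤ (f : ℝ[X]).eval y) ∧ (f : ℝ[X]).coeff n ≠ 0 ∧
      L f = a * (f : ℝ[X]).eval x ∧
      ∀ g : V, (∀ y, 0 ≤ (g : ℝ[X]).eval y) → a * (g : ℝ[X]).eval x ≤ L g := by
  have := finiteDimensional_of_le_degreeLE hV
  let M : V := ⟨X ^ n, hX⟩
  have hMx (x : ℝ) : (M : ℝ[X]).eval x = x ^ n := by rw [eval_pow, eval_X]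
  have hMpos (x : ℝ) : 0 ≤ (M : ℝ[X]).eval x := (hMx x).symm ▸ hn.pow_nonneg x
  have hM0 : M ≠ 0 := fun h => pow_ne_zero n X_ne_zero (congrArg Subtype.val h)
  obtain ⟨c, hc⟩ := exists_abs_coeff_le hV hL hMpos hM0
  obtain ⟨x, hxc, hx⟩ : ∃ x : ℝ, ∑ i ∈ Finset.range n, L M * c i * x ^ i < x ^ n ∧ 0 < x :=
    ((eventually_sum_mul_pow_lt (fun i => L M * c i) n).and (eventually_gt_atTop 0)).exists
  obtain ⟨f, hf, hf1, hmax⟩ := exists_abs_le_abs_mul (e := pointEval V) hL hMpos hM0 (pointEval V x)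
  simp only [pointEval_apply] at hf hmax
  rw [abs_of_nonneg (hf x)] at hmax
  have hMle : x ^ n ≤ (f : ℝ[X]).eval x * L M := by
    simpa only [hMx, abs_of_nonneg (hn.pow_nonneg x)] using hmax M hMpos
  have hfx : 0 < (f : ℝ[X]).eval x :=
    pos_of_mul_pos_left ((pow_pos hx n).trans_le hMle) (hL M hMpos hM0).le
  refine ⟨((f : ℝ[X]).eval x)⁻¹, (inv_pos.mpr hfx).le, x, f, hf, fun hfn => ?_, ?_, fun g hg => ?_⟩
  · have hle : (f : ℝ[X]).eval x ≤ ∑ i ∈ Finset.range n, c i * x ^ i := by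
      rw [eval_eq_sum_range' (Nat.lt_succ_of_le (natDegree_le_of_degree_le
        (mem_degreeLE.mp (hV f.2)))), Finset.sum_range_succ, hfn, zero_mul, add_zero]
      refine Finset.sum_le_sum fun i _ => mul_le_mul_of_nonneg_right ?_ (pow_nonneg hx.le i)
      exact (le_abs_self _).trans ((hc i f hf).trans_eq (by rw [hf1, mul_one]))
    refine (hMle.trans (mul_le_mul_of_nonneg_right hle (hL M hMpos hM0).le)).not_gt ?_
    simpa only [mul_comm _ (L M), Finset.mul_sum, mul_assoc] using hxc
  · rw [hf1, inv_mul_cancel₀ hfx.ne']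
  · rw [inv_mul_le_iff₀ hfx]
    exact (le_abs_self _).trans (hmax g hg)

theorem exists_le_isConicCombination (hV : V ≤ degreeLE ℝ n) (h1 : 1 ∈ V) (hX : X ^ n ∈ V)
    (hn : Even n) {N : ℕ} (hN : ∀ f ∈ V, f ≠ 0 → (∀ x, 0 ≤ f.eval x) →
      Interpolates V f.roots.toFinset ∧ #f.roots.toFinset ≤ N)
    (hL : IsMomentFunctional L) : ∃ m ≤ N + 1, IsConicCombination L m := by
  have hsupport {L : V →ₗ[ℝ] ℝ} {f : V} (hf : ∀ x, 0 ≤ (f : ℝ[X]).eval x) (hf0 : f ≠ 0)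
      (hL : ∀ g : V, (∀ x, (f : ℝ[X]).eval x = 0 → 0 ≤ (g : ℝ[X]).eval x) → 0 ≤ L g) :
      ∃ m ≤ N, IsConicCombination L m := by
    have hf0' : (f : ℝ[X]) ≠ 0 := fun h => hf0 (Subtype.ext h)
    obtain ⟨hZ, hcard⟩ := hN f f.2 hf0' hf
    exact ⟨_, hcard, isConicCombination_of_nonneg_on hZ fun g hg => hL g fun x hx => hg x
      ((mem_roots_toFinset hf0').mpr hx)⟩
  by_cases hpos : ∀ g : V, (∀ x, 0 ≤ (g : ℝ[X]).eval x) → g ≠ 0 → 0 < L g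
  · obtain ⟨a, ha, x, f, hf, hfn, hLf, hmin⟩ :=
      exists_coeff_ne_zero_and_mul_eval_le hV hX hn hpos
    have hf0 : f ≠ 0 := fun h => hfn (by rw [h, Submodule.coe_zero, coeff_zero])
    have happ (g : V) : (L - a • pointEval V x) g = L g - a * (g : ℝ[X]).eval x := rfl
    obtain ⟨m, hm, hconic⟩ := hsupport hf hf0 (L := L - a • pointEval V x) fun g =>
      nonneg_of_nonneg_on_zeros h1 (fun g hg => by rw [happ]; exact sub_nonneg.mpr (hmin g hg))
        hf (by rw [happ, hLf, sub_self])
        ((mem_degreeLE.mp (hV g.2)).trans (le_degree_of_ne_zero hfn))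
    refine ⟨m + 1, Nat.succ_le_succ hm, ?_⟩
    simpa only [sub_add_cancel] using hconic.add_smul_pointEval ha x
  · push Not at hpos
    obtain ⟨f, hf, hf0, hLf⟩ := hpos
    obtain ⟨m, hm, hconic⟩ := hsupport hf hf0 fun g =>
      hL.nonneg_of_nonneg_on_zeros hf (hLf.antisymm (hL.nonneg hf))
    exact ⟨m, hm.trans N.le_succ, hconic⟩

end PositiveFunctionals

section GapRingFunctionals

variable {r : ℕ} {d : Fin r → ℕ} {k : ℕ}

theorem exists_two_mul_le_isConicCombination (hd : Finset.univ.gcd d = 1) (hk : conductor d ≤ k)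
    {L : gapRingLE d (2 * k) →ₗ[ℝ] ℝ} (hL : IsMomentFunctional L) :
    ∃ n, 2 * n ≤ descartesNumber d (2 * k) + 2 ∧ IsConicCombination L n := by
  have hX : (X : ℝ[X]) ^ (2 * k) ∈ gapRingLE d (2 * k) := mem_gapRingLE_iff.mpr
    ⟨X_pow_mem_gapRing hd (hk.trans (Nat.le_mul_of_pos_left k two_pos)), natDegree_X_pow_le _⟩
  obtain ⟨n, hn, hconic⟩ := exists_le_isConicCombination (N := descartesNumber d (2 * k) / 2)
    inf_le_right (C_mem_gapRingLE d _ 1) hX (even_two_mul k) (fun f hf hf0 hpos => by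
      have hcard := two_mul_card_roots_le_descartesNumber hf hf0 hpos
      have hle := descartesNumber_le_self d (2 * k)
      exact ⟨interpolates_gapRingLE hd hk (by omega), by omega⟩) hL
  exact ⟨n, by omega, hconic⟩

theorem exists_isMomentFunctional_forall_descartesNumber_le (hd : Finset.univ.gcd d = 1)
    (hk : conductor d ≤ k) : ∃ L : gapRingLE d (2 * k) →ₗ[ℝ] ℝ, IsMomentFunctional L ∧
      ∀ n, IsConicCombination L n → descartesNumber d k ≤ n := by
  obtain ⟨p, hp, hp0, hcard⟩ := exists_card_roots_eq_descartesNumber d k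
  obtain ⟨hpR, hpk⟩ := mem_gapRingLE_iff.mp hp
  have hsq : p ^ 2 ∈ gapRingLE d (2 * k) :=
    mem_gapRingLE_iff.mpr ⟨pow_mem hpR 2, natDegree_pow_le_of_le 2 hpk⟩
  have hZ : Interpolates (gapRingLE d (2 * k)) p.roots.toFinset :=
    interpolates_gapRingLE hd hk (hcard.trans_le (descartesNumber_le_self d k))
  refine ⟨_, isMomentFunctional_sum_pointEval _ p.roots.toFinset, fun n hn => hcard ▸ ?_⟩
  refine card_le_of_isConicCombination_sum hZ (q := ⟨p ^ 2, hsq⟩) (fun x => ?_) (fun x => ?_) hn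
  · rw [eval_pow]
    exact sq_nonneg _
  · rw [eval_pow, sq_eq_zero_iff, mem_roots_toFinset hp0]

end GapRingFunctionals

end SparseMoment

end

theorem mainTheorem9 {r : ℕ} (d : Fin r → ℕ) (hd : Finset.univ.gcd d = 1)
    (k : ℕ) (hk : SparseMoment.conductor d ≤ k) :
    (∀ L : SparseMoment.gapRingLE d (2 * k) →ₗ[ℝ] ℝ, SparseMoment.IsMomentFunctional L →
      ∃ n : ℕ,
        (n : ℤ) ≤ (k : ℤ) + 1 -
          ⌈((SparseMoment.conductor d : ℚ) -
            (SparseMoment.descartesNumber d (SparseMoment.conductor d) : ℚ) - 1) / 2⌉ ∧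
        SparseMoment.IsConicCombination L n) ∧
    (∃ L : SparseMoment.gapRingLE d (2 * k) →ₗ[ℝ] ℝ, SparseMoment.IsMomentFunctional L ∧
      ∀ n : ℕ, SparseMoment.IsConicCombination L n →
        (k : ℤ) - ((SparseMoment.conductor d : ℤ) -
          (SparseMoment.descartesNumber d (SparseMoment.conductor d) : ℤ)) ≤ (n : ℤ)) := by
  set c := SparseMoment.conductor d
  set D := SparseMoment.descartesNumber d c
  constructor
  · intro L hL
    obtain ⟨n, hn, hconic⟩ := SparseMoment.exists_two_mul_le_isConicCombination hd hk hL
    obtain ⟨j, hj⟩ := Nat.exists_eq_add_of_le (hk.trans (Nat.le_mul_of_pos_left k two_pos))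
    have hD := SparseMoment.descartesNumber_le_add d c j
    rw [← hj] at hD
    have hn' : (2 * n : ℚ) ≤ D + j + 3 := by exact_mod_cast (by omega : 2 * n ≤ D + j + 3)
    have hj' : (2 * k : ℚ) = c + j := by exact_mod_cast hj
    refine ⟨n, ?_, hconic⟩
    rw [le_sub_comm, Int.ceil_le]
    push_cast
    linarith
  · obtain ⟨L, hL, hmin⟩ :=
      SparseMoment.exists_isMomentFunctional_forall_descartesNumber_le hd hk
    refine ⟨L, hL, fun n hn => ?_⟩
    have hle : D + (k - c) ≤ n :=
      (SparseMoment.descartesNumber_conductor_add_le hd hk).trans (hmin n hn)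
    omega
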